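/- Let $L$ be a Lie algebra over a field $K$. Write $L^2=[L,L]$, $L^3=[L,L^2]$, let $Z(L)$ be the centre of $L$, and let $A(n)$ be the abelian Lie algebra of dimension $n$. The Lie algebra $L$ is a \emph{$d$-generator} Lie algebra if $d$ is the least number of elements that generate it, and a \emph{generalized Heisenberg Lie algebra of rank $m$} if $L^2=Z(L)$ and $\dim L^2=m$. If $L\cong F/R$ with $F$ a free Lie algebra, the Schur multiplier of $L$ is $\mathcal M(L)=(R\cap F^2)/[R,F]$. A \emph{defining pair} for $L$ is a pair $(E,M)$ of a Lie algebra $E$ and an ideal $M\subseteq Z(E)\cap E^2$ of $E$ with $E/M\cong L$; a \emph{cover} of $L$ is an algebra $E$ occurring in a defining pair $(E,M)$ for $L$ whose dimension is maximal among all defining pairs for $L$. \textbf{Theorem.} Let $L$ be a $d$-generator generalized Heisenberg Lie algebra of rank $m=\frac12 d(d-1)-r$, where $r\in\{1,2,3\}$, and let $L^*$ be a Lie algebra over $K$. Then $\mathcal M(L)$ is finite-dimensional, and $L^*$ is a cover of $L$ if and only if $L^*$ is nilpotent of class exactly $3$, $Z(L^*)\subseteq (L^*)^2$, and one of the following holds: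 (a) $(L^*)^3\cong\mathcal M(L)$ and $L^*/(L^*)^3\cong L$; (b) for some $j$ with $1\le j\le r$, one has $(L^*)^3\cong A(\dim\mathcal M(L)-j)$ (with $j\le\dim\mathcal M(L)$), and $L^*$ has a central ideal $A\cong A(j)$ with $(L^*)^3\cap A=0$ and $L^*/\big((L^*)^3\oplus A\big)\cong L$. -/

import Mathlib

universe u

section HeisenbergCovers

variable (K : Type u) [Field K]

/-- The square `L² = [L, L]`. -/
abbrev lieSq (L : Type u) [LieRing L] [LieAlgebra K L] : LieIdeal K L :=
  LieModule.lowerCentralSeries K L L 1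

/-- The cube `L³ = [L, [L, L]]`. -/
abbrev lieCube (L : Type u) [LieRing L] [LieAlgebra K L] : LieIdeal K L :=
  LieModule.lowerCentralSeries K L L 2

/-- `A(n)`, the abelian Lie algebra of dimension `n`: the vector space `Kⁿ` with zero bracket. -/
def AbelianLie (n : ℕ) : Type u := Fin n → K

instance (n : ℕ) : AddCommGroup (AbelianLie K n) := inferInstanceAs (AddCommGroup (Fin n → K))

instance (n : ℕ) : Module K (AbelianLie K n) := inferInstanceAs (Module K (Fin n → K))

instance (n : ℕ) : LieRing (AbelianLie K n) where
  bracket _ _ := 0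
  add_lie _ _ _ := (add_zero 0).symm
  lie_add _ _ _ := (add_zero 0).symm
  lie_self _ := rfl
  leibniz_lie _ _ _ := (add_zero 0).symm

instance (n : ℕ) : LieAlgebra K (AbelianLie K n) where
  lie_smul t _ _ := (smul_zero t).symm

/-- `L` is a generalized Heisenberg Lie algebra of rank `n`: `L² = Z(L)` and `dim L² = n`. -/
def IsGeneralizedHeisenberg (L : Type u) [LieRing L] [LieAlgebra K L] (n : ℕ) : Prop :=
  lieSq K L = LieAlgebra.center K L ∧
    Module.Finite K (lieSq K L) ∧ Module.finrank K (lieSq K L) = n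

/-- `L` is a `d`-generator Lie algebra: `d` is the least size of a finite generating set. -/
def IsGeneratorNumber (L : Type u) [LieRing L] [LieAlgebra K L] (d : ℕ) : Prop :=
  IsLeast {k : ℕ | ∃ s : Finset L, s.card = k ∧ LieSubalgebra.lieSpan K L (s : Set L) = ⊤} d

/-- `L` is nilpotent of class exactly `c`. -/
def IsNilpotentOfClass (L : Type u) [LieRing L] (c : ℕ) : Prop :=
  LieRing.IsNilpotent L ∧ LieModule.nilpotencyLength L L = c

variable {K} in
/-- The Schur multiplier `(R ∩ F²) / [R, F]` computed from a free presentation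
`0 → R → F → L → 0`, where `F` is the free Lie algebra on `X`, the map `F → L` is `π`
and `R = ker π`. -/
abbrev SchurMultiplier {X L : Type u} [LieRing L] [LieAlgebra K L]
    (π : FreeLieAlgebra K X →ₗ⁅K⁆ L) : Type u :=
  (π.ker ⊓ lieSq K (FreeLieAlgebra K X) : LieIdeal K (FreeLieAlgebra K X)) ⧸
    LieIdeal.comap (π.ker ⊓ lieSq K (FreeLieAlgebra K X)).incl
      ⁅π.ker, (⊤ : LieIdeal K (FreeLieAlgebra K X))⁆

/-- `(E, M)` is a defining pair for `L`: `M ⊆ Z(E) ∩ E²` and `E / M ≅ L`. -/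
def IsDefiningPair (L E : Type u) [LieRing L] [LieAlgebra K L] [LieRing E] [LieAlgebra K E]
    (M : LieIdeal K E) : Prop :=
  M ≤ LieAlgebra.center K E ⊓ lieSq K E ∧ Nonempty ((E ⧸ M) ≃ₗ⁅K⁆ L)

/-- `E` is a cover of `L`: it is the first member of a defining pair for `L`, and its dimension
is the largest possible among the defining pairs for `L`. -/
def IsCover (L E : Type u) [LieRing L] [LieAlgebra K L] [LieRing E] [LieAlgebra K E] : Prop :=
  (∃ M : LieIdeal K E, IsDefiningPair K L E M) ∧
    ∀ (E' : Type u) [LieRing E'] [LieAlgebra K E'] (M' : LieIdeal K E'),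
      IsDefiningPair K L E' M' → Module.rank K E' ≤ Module.rank K E

variable {K} in
/-- `E³ ≅ A(dim M(L) - j)` and `E / (E³ ⊕ A(j)) ≅ L`, where `A(j)` is (embedded as) a central
ideal of `E` that meets `E³` trivially. -/
def HasCubeSplitting {X L : Type u} [LieRing L] [LieAlgebra K L]
    (π : FreeLieAlgebra K X →ₗ⁅K⁆ L) (E : Type u) [LieRing E] [LieAlgebra K E] (j : ℕ) : Prop :=
  (∃ n : ℕ, n + j = Module.finrank K (SchurMultiplier π) ∧
      Nonempty (lieCube K E ≃ₗ⁅K⁆ AbelianLie K n)) ∧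
    ∃ A : LieIdeal K E, A ≤ LieAlgebra.center K E ∧ Nonempty (A ≃ₗ⁅K⁆ AbelianLie K j) ∧
      Disjoint (lieCube K E) A ∧ Nonempty ((E ⧸ (lieCube K E ⊔ A)) ≃ₗ⁅K⁆ L)

variable {K} in
/-- `E³ ≅ M(L)` and `E / E³ ≅ L`. -/
def HasCubeMultiplier {X L : Type u} [LieRing L] [LieAlgebra K L]
    (π : FreeLieAlgebra K X →ₗ⁅K⁆ L) (E : Type u) [LieRing E] [LieAlgebra K E] : Prop :=
  Nonempty (lieCube K E ≃ₗ⁅K⁆ SchurMultiplier π) ∧ Nonempty ((E ⧸ lieCube K E) ≃ₗ⁅K⁆ L)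

end HeisenbergCovers

/-! ### Stem extensions and defining pairs -/

section StemExtensions

variable {K : Type u} [Field K]
variable {L E : Type u} [LieRing L] [LieAlgebra K L] [LieRing E] [LieAlgebra K E]

/-! Write `L = F/R`. A defining pair is a stem extension `p : E → L`, and a lift `φ : F → E` of the
presentation kills `[R, F]` and maps `R ∩ F²` onto `ker p`. Hence `dim ker p ≤ dim M(L)`. A suitable
quotient of `F` attains equality, so the covers of a finite-dimensional `L` are the stem extensions
with `dim ker p = dim M(L)`; for them `φ` is injective on `R ∩ F²` modulo `[R, F]`
(`mem_of_lift_eq_zero`).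

Let `L` be generalized Heisenberg and `E` a cover. Since `L³ = 0`, `E³ ⊆ ker p` is central, and the
claim reduces to `E³ ≠ 0` and `1 ≤ j ≤ r` for `j = dim ker p - dim E³`. The upper bound is a count:
`dim E² = m + dim ker p`, while brackets of a basis of `E/E²` span `E²/E³`, so `dim E² ≤ d(d-1)/2 +
dim E³`.

The other two facts are transferred to the cover from one-dimensional central extensions of `L`. As
`m < d(d-1)/2`, the bracket map `⋀²(L/L²) → L²` has a kernel, which gives a nontrivial stem
extension of class at most two and hence `ker p ⊄ E³` (`not_ker_le_lieCube_of_stem`). As `C(d,3) <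
md`, some nonzero form on `L² ⊗ L/L²` satisfies the Jacobi condition, which gives a stem extension
with nonzero cube and hence `E³ ≠ 0` (`lieCube_ne_bot_of_stem`). Covers thus always fall under
alternative (b).

Conversely, class three makes `E³` central, `Z(E) ⊆ E²` puts `A` inside `E²`, and the prescribed
dimensions make the kernel as large as `M(L)`. -/

theorem lieSq_toSubmodule :
    (lieSq K L).toSubmodule = Submodule.span K {z | ∃ x y : L, ⁅x, y⁆ = z} := by
  simp [LieModule.lowerCentralSeries_succ, LieSubmodule.lieIdeal_oper_eq_linear_span']

theorem lieCube_toSubmodule :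
    (lieCube K L).toSubmodule = Submodule.span K {z | ∃ x : L, ∃ y ∈ lieSq K L, ⁅x, y⁆ = z} := by
  rw [lieCube, LieModule.lowerCentralSeries_succ, LieSubmodule.lieIdeal_oper_eq_linear_span']
  simp

theorem lie_mem_lieSq (x y : L) : ⁅x, y⁆ ∈ lieSq K L := by
  rw [← LieSubmodule.mem_toSubmodule, lieSq_toSubmodule]
  exact Submodule.subset_span ⟨x, y, rfl⟩

theorem lie_mem_lieCube (x : L) {y : L} (hy : y ∈ lieSq K L) : ⁅x, y⁆ ∈ lieCube K L := by
  rw [← LieSubmodule.mem_toSubmodule, lieCube_toSubmodule]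
  exact Submodule.subset_span ⟨x, y, hy, rfl⟩

theorem lieSq_le_iff {P : Submodule K L} :
    (lieSq K L).toSubmodule ≤ P ↔ ∀ x y : L, ⁅x, y⁆ ∈ P := by
  rw [lieSq_toSubmodule, Submodule.span_le]
  exact ⟨fun h x y ↦ h ⟨x, y, rfl⟩, by rintro h _ ⟨x, y, rfl⟩; exact h x y⟩

theorem lieCube_le_iff {P : Submodule K L} :
    (lieCube K L).toSubmodule ≤ P ↔ ∀ x : L, ∀ y ∈ lieSq K L, ⁅x, y⁆ ∈ P := by
  rw [lieCube_toSubmodule, Submodule.span_le]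
  exact ⟨fun h x y hy ↦ h ⟨x, y, hy, rfl⟩, by rintro h _ ⟨x, y, hy, rfl⟩; exact h x y hy⟩

theorem lieCube_le_lieSq : lieCube K L ≤ lieSq K L :=
  LieModule.antitone_lowerCentralSeries K L L one_le_two

theorem map_mem_lowerCentralSeries (f : E →ₗ⁅K⁆ L) (k : ℕ) {x : E}
    (hx : x ∈ LieModule.lowerCentralSeries K E E k) :
    f x ∈ LieModule.lowerCentralSeries K L L k :=
  LieIdeal.map_lowerCentralSeries_le k (LieIdeal.mem_map hx)

theorem exists_mem_lowerCentralSeries_of_surjective {f : E →ₗ⁅K⁆ L} (hf : Function.Surjective f)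
    (k : ℕ) {y : L} (hy : y ∈ LieModule.lowerCentralSeries K L L k) :
    ∃ x ∈ LieModule.lowerCentralSeries K E E k, f x = y := by
  rw [← LieIdeal.lowerCentralSeries_map_eq k hf] at hy
  obtain ⟨x, hx⟩ := LieIdeal.mem_map_of_surjective hf hy
  exact ⟨x, x.2, hx⟩

/-- A stem extension of `L`: a surjective homomorphism onto `L` whose kernel lies in the centre and
in the square. -/
def IsStem (p : E →ₗ⁅K⁆ L) : Prop :=
  Function.Surjective p ∧ p.ker ≤ LieAlgebra.center K E ⊓ lieSq K E

/-- A surjective homomorphism of Lie algebras identifies its target with the quotient by its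
kernel. -/
theorem nonempty_quotKer_equiv {p : E →ₗ⁅K⁆ L} (hp : Function.Surjective p) :
    Nonempty ((E ⧸ p.ker) ≃ₗ⁅K⁆ L) := by
  refine ⟨p.quotKerEquivRange.trans ?_⟩
  rw [LieHom.range_eq_top p |>.2 hp]
  exact LieSubalgebra.topEquiv

/-- The projection onto the quotient by an ideal, as a homomorphism of Lie algebras. -/
def quotientProj (M : LieIdeal K E) : E →ₗ⁅K⁆ E ⧸ M :=
  { (LieSubmodule.Quotient.mk' M : E →ₗ[K] E ⧸ M) with map_lie' := fun {_ _} ↦ rfl }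

theorem isDefiningPair_iff {M : LieIdeal K E} :
    IsDefiningPair K L E M ↔ ∃ p : E →ₗ⁅K⁆ L, IsStem p ∧ p.ker = M := by
  constructor
  · rintro ⟨hM, ⟨e⟩⟩
    have hker : (e.toLieHom.comp (quotientProj M)).ker = M := by
      ext x
      rw [LieHom.mem_ker]
      change e (LieSubmodule.Quotient.mk x) = 0 ↔ _
      rw [EmbeddingLike.map_eq_zero_iff, LieSubmodule.Quotient.mk_eq_zero']
    refine ⟨e.toLieHom.comp (quotientProj M), ⟨?_, hker.trans_le hM⟩, hker⟩
    exact e.surjective.comp (LieSubmodule.Quotient.surjective_mk' M)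
  · rintro ⟨p, hp, rfl⟩
    exact ⟨hp.2, nonempty_quotKer_equiv hp.1⟩

theorem rank_eq_of_surjective {p : E →ₗ⁅K⁆ L} (hp : Function.Surjective p) :
    Module.rank K E = Module.rank K L + Module.rank K p.ker := by
  rw [← LinearMap.rank_range_add_rank_ker (p : E →ₗ[K] L),
    LinearMap.range_eq_top.2 hp, rank_top]
  rfl

namespace IsStem

variable {p : E →ₗ⁅K⁆ L} (hp : IsStem p)
include hp

theorem lie_eq_zero {x : E} (hx : p x = 0) (y : E) : ⁅y, x⁆ = 0 :=
  (hp.2 hx).1 y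

theorem lie_eq_zero' {x : E} (hx : p x = 0) (y : E) : ⁅x, y⁆ = 0 := by
  rw [← lie_skew, hp.lie_eq_zero hx, neg_zero]

theorem mem_lieSq {x : E} (hx : p x = 0) : x ∈ lieSq K E := (hp.2 hx).2

/-- Central kernel: the bracket of `E` depends only on the images in `L`, so `E²` can be computed
from any set of lifts. -/
theorem lie_eq_of_map_eq {x x' y y' : E} (hx : p x = p x') (hy : p y = p y') :
    ⁅x, y⁆ = ⁅x', y'⁆ := by
  have h1 := hp.lie_eq_zero' (x := x - x') (by rw [map_sub, hx, sub_self]) y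
  have h2 := hp.lie_eq_zero (x := y - y') (by rw [map_sub, hy, sub_self]) x'
  rw [sub_lie, sub_eq_zero] at h1
  rw [lie_sub, sub_eq_zero] at h2
  rw [h1, h2]

theorem mem_lieSq_iff {x : E} : x ∈ lieSq K E ↔ p x ∈ lieSq K L := by
  refine ⟨map_mem_lowerCentralSeries p 1, fun h ↦ ?_⟩
  obtain ⟨y, hy, hyx⟩ := exists_mem_lowerCentralSeries_of_surjective hp.1 1 h
  have := hp.mem_lieSq (x := x - y) (by rw [map_sub, hyx, sub_self])
  simpa using add_mem this hy

end IsStem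

/-! ### Lifting free presentations; the Schur multiplier bounds kernels of stem extensions -/

section Lifts

variable {X : Type u} {π : FreeLieAlgebra K X →ₗ⁅K⁆ L}

theorem exists_lift (π : FreeLieAlgebra K X →ₗ⁅K⁆ L) {p : E →ₗ⁅K⁆ L}
    (hp : Function.Surjective p) : ∃ φ : FreeLieAlgebra K X →ₗ⁅K⁆ E, ∀ f, p (φ f) = π f := by
  choose s hs using hp
  refine ⟨FreeLieAlgebra.lift K fun x ↦ s (π (FreeLieAlgebra.of K x)), fun f ↦ ?_⟩
  have : p.comp (FreeLieAlgebra.lift K fun x ↦ s (π (FreeLieAlgebra.of K x))) = π :=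
    FreeLieAlgebra.hom_ext fun x ↦ by simp [hs]
  exact DFunLike.congr_fun this f

variable {p : E →ₗ⁅K⁆ L} {φ : FreeLieAlgebra K X →ₗ⁅K⁆ E}

theorem lift_eq_zero_of_mem (hp : IsStem p) (hφ : ∀ f, p (φ f) = π f) {f : FreeLieAlgebra K X}
    (hf : f ∈ ⁅π.ker, (⊤ : LieIdeal K (FreeLieAlgebra K X))⁆) : φ f = 0 := by
  have : ⁅π.ker, (⊤ : LieIdeal K (FreeLieAlgebra K X))⁆ ≤ φ.ker := by
    rw [LieSubmodule.lie_le_iff]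
    intro x hx y _
    rw [LieHom.mem_ker, LieHom.map_lie]
    exact hp.lie_eq_zero' ((hφ x).trans hx) _
  exact this hf

/-- `φ` need not be known to be onto: it reaches every class modulo the central `ker p`, and
brackets see nothing more. -/
theorem exists_lieSq_lift (hπ : Function.Surjective π) (hp : IsStem p)
    (hφ : ∀ f, p (φ f) = π f) {y : E} (hy : y ∈ lieSq K E) :
    ∃ f ∈ lieSq K (FreeLieAlgebra K X), φ f = y := by
  have : (lieSq K E).toSubmodule ≤
      (lieSq K (FreeLieAlgebra K X)).toSubmodule.map (φ : FreeLieAlgebra K X →ₗ[K] E) := by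
    rw [lieSq_le_iff]
    intro x y
    obtain ⟨a, ha⟩ := hπ (p x)
    obtain ⟨b, hb⟩ := hπ (p y)
    refine ⟨⁅a, b⁆, lie_mem_lieSq a b, ?_⟩
    rw [LieHom.coe_toLinearMap, LieHom.map_lie]
    exact hp.lie_eq_of_map_eq (by rw [hφ, ha]) (by rw [hφ, hb])
  exact this hy

/-- `E = φ(F) + ker p`, and `ker p ⊆ E² = φ(F²)`. -/
theorem lift_surjective (hπ : Function.Surjective π) (hp : IsStem p)
    (hφ : ∀ f, p (φ f) = π f) : Function.Surjective φ := by
  intro y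
  obtain ⟨a, ha⟩ := hπ (p y)
  obtain ⟨b, -, hb⟩ := exists_lieSq_lift hπ hp hφ
    (hp.mem_lieSq (x := y - φ a) (by rw [map_sub, hφ, ha, sub_self]))
  exact ⟨a + b, by rw [map_add, hb, add_sub_cancel]⟩

/-- A homomorphism that kills `[R, F]` induces a linear map on the Schur multiplier. -/
noncomputable def multiplierMap (φ : FreeLieAlgebra K X →ₗ⁅K⁆ E)
    (h : ∀ f ∈ ⁅π.ker, (⊤ : LieIdeal K (FreeLieAlgebra K X))⁆, φ f = 0) :
    SchurMultiplier π →ₗ[K] E :=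
  Submodule.liftQ
    (LieIdeal.comap (π.ker ⊓ lieSq K (FreeLieAlgebra K X)).incl
      ⁅π.ker, (⊤ : LieIdeal K (FreeLieAlgebra K X))⁆).toSubmodule
    ((φ : FreeLieAlgebra K X →ₗ[K] E) ∘ₗ
      (π.ker ⊓ lieSq K (FreeLieAlgebra K X)).toSubmodule.subtype)
    fun _ hf ↦ h _ hf

theorem range_multiplierMap (h : ∀ f ∈ ⁅π.ker, (⊤ : LieIdeal K (FreeLieAlgebra K X))⁆, φ f = 0) :
    LinearMap.range (multiplierMap φ h) =
      (π.ker ⊓ lieSq K (FreeLieAlgebra K X)).toSubmodule.map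
        (φ : FreeLieAlgebra K X →ₗ[K] E) := by
  ext y
  constructor
  · rintro ⟨x, rfl⟩
    obtain ⟨⟨f, hf⟩, rfl⟩ := LieSubmodule.Quotient.surjective_mk' _ x
    exact ⟨f, hf, rfl⟩
  · rintro ⟨f, hf, rfl⟩
    exact ⟨LieSubmodule.Quotient.mk ⟨f, hf⟩, rfl⟩

theorem map_ker_inf_lieSq (hπ : Function.Surjective π) (hp : IsStem p)
    (hφ : ∀ f, p (φ f) = π f) :
    (π.ker ⊓ lieSq K (FreeLieAlgebra K X)).toSubmodule.map (φ : FreeLieAlgebra K X →ₗ[K] E) =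
      p.ker.toSubmodule := by
  apply le_antisymm
  · rintro _ ⟨f, hf, rfl⟩
    exact (hφ f).trans hf.1
  · intro y hy
    obtain ⟨f, hf, rfl⟩ := exists_lieSq_lift hπ hp hφ (hp.mem_lieSq hy)
    exact ⟨f, ⟨(hφ f).symm.trans hy, hf⟩, rfl⟩

theorem rank_ker_le (hπ : Function.Surjective π) (hp : IsStem p) :
    Module.rank K p.ker ≤ Module.rank K (SchurMultiplier π) := by
  obtain ⟨φ, hφ⟩ := exists_lift π hp.1
  have h := range_multiplierMap (φ := φ) fun f hf ↦ lift_eq_zero_of_mem hp hφ hf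
  rw [map_ker_inf_lieSq hπ hp hφ] at h
  change Module.rank K p.ker.toSubmodule ≤ _
  rw [← h]
  exact rank_range_le _

/-- If the kernel of a stem extension is as large as the Schur multiplier, then a lift of the
presentation has kernel `[R, F]` on `R ∩ F²`. -/
theorem mem_of_lift_eq_zero (hπ : Function.Surjective π) (hp : IsStem p)
    (hφ : ∀ f, p (φ f) = π f) [Module.Finite K (SchurMultiplier π)]
    (hdim : Module.finrank K p.ker = Module.finrank K (SchurMultiplier π))
    {f : FreeLieAlgebra K X} (h1 : π f = 0) (h2 : f ∈ lieSq K (FreeLieAlgebra K X))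
    (h3 : φ f = 0) : f ∈ ⁅π.ker, (⊤ : LieIdeal K (FreeLieAlgebra K X))⁆ := by
  set g := multiplierMap (π := π) φ fun f hf ↦ lift_eq_zero_of_mem hp hφ hf with hg
  have hr : LinearMap.range g = p.ker.toSubmodule := by
    rw [hg, range_multiplierMap, map_ker_inf_lieSq hπ hp hφ]
  -- `g` maps the multiplier onto a space of the same finite dimension, so it is injective.
  have hker : LinearMap.ker g = ⊥ := by
    have := LinearMap.finrank_range_add_finrank_ker g
    rw [hr] at this
    change Module.finrank K p.ker + _ = _ at this
    rw [← Submodule.finrank_eq_zero]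
    omega
  rw [LinearMap.ker_eq_bot'] at hker
  have := hker (LieSubmodule.Quotient.mk (⟨f, h1, h2⟩ : (π.ker ⊓ lieSq K (FreeLieAlgebra K X) :
    LieIdeal K (FreeLieAlgebra K X)))) h3
  rw [LieSubmodule.Quotient.mk_eq_zero'] at this
  exact this

/-- There is a stem extension whose kernel is the Schur multiplier. -/
theorem exists_stem_of_multiplier (hπ : Function.Surjective π) :
    ∃ (E : Type u) (_ : LieRing E) (_ : LieAlgebra K E) (p : E →ₗ⁅K⁆ L), IsStem p ∧
      Nonempty (SchurMultiplier π ≃ₗ[K] p.ker) := by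
  set B := ⁅π.ker, (⊤ : LieIdeal K (FreeLieAlgebra K X))⁆ with hB
  set N := π.ker ⊓ lieSq K (FreeLieAlgebra K X) with hN
  have hBR : B ≤ π.ker := LieSubmodule.lie_le_left _ _
  have hBN : B ≤ N := by
    refine le_inf hBR ?_
    rw [hB, LieSubmodule.lie_le_iff]
    exact fun x _ y _ ↦ lie_mem_lieSq x y
  -- `S` is chosen with `N + S = R` and `N ∩ S = B`, so that the kernel `R/S` of `F/S → L` is `N/B`,
  -- the multiplier. Any subspace between `[R, F]` and `R` is an ideal.
  obtain ⟨C, hC⟩ := Submodule.exists_isCompl N.toSubmodule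
  set T : Submodule K (FreeLieAlgebra K X) := B.toSubmodule ⊔ (C ⊓ π.ker.toSubmodule) with hT
  have hTR : T ≤ π.ker.toSubmodule := sup_le hBR inf_le_right
  let S : LieIdeal K (FreeLieAlgebra K X) :=
    { T with
      lie_mem := by
        intro x y hy
        have : ⁅x, y⁆ ∈ B := by
          rw [← lie_skew]
          exact neg_mem (LieSubmodule.lie_mem_lie (hTR hy) (LieSubmodule.mem_top x))
        exact le_sup_left (a := B.toSubmodule) this }
  have hSR : S ≤ π.ker := hTR
  have hBS : B ≤ S := le_sup_left (a := B.toSubmodule)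
  have hsup : π.ker.toSubmodule ≤ N.toSubmodule ⊔ T := by
    have : (N.toSubmodule ⊔ C) ⊓ π.ker.toSubmodule ≤
        N.toSubmodule ⊔ (C ⊓ π.ker.toSubmodule) :=
      (sup_inf_assoc_of_le C (inf_le_left : N ≤ π.ker)).le
    rw [hC.sup_eq_top, top_inf_eq] at this
    exact this.trans (sup_le_sup_left le_sup_right _)
  -- Modular law, using `B ≤ N` and `C ∩ N = 0`.
  have hinf : N.toSubmodule ⊓ T ≤ B.toSubmodule := by
    have : (B.toSubmodule ⊔ (C ⊓ π.ker.toSubmodule)) ⊓ N.toSubmodule ≤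
        B.toSubmodule ⊔ (C ⊓ π.ker.toSubmodule) ⊓ N.toSubmodule :=
      (sup_inf_assoc_of_le _ (show B.toSubmodule ≤ N.toSubmodule from hBN)).le
    rw [inf_comm]
    refine this.trans (sup_le le_rfl ?_)
    have h0 : C ⊓ N.toSubmodule ≤ ⊥ := by rw [inf_comm, hC.inf_eq_bot]
    exact (inf_le_inf_right _ inf_le_left).trans (h0.trans bot_le)
  let p : (FreeLieAlgebra K X ⧸ S) →ₗ⁅K⁆ L :=
    { Submodule.liftQ S.toSubmodule (π : FreeLieAlgebra K X →ₗ[K] L) hSR with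
      map_lie' := by
        intro x y
        obtain ⟨x, rfl⟩ := LieSubmodule.Quotient.surjective_mk' S x
        obtain ⟨y, rfl⟩ := LieSubmodule.Quotient.surjective_mk' S y
        exact π.map_lie x y }
  have hpφ : ∀ f, p (quotientProj S f) = π f := fun f ↦ rfl
  have hφ0 : ∀ f, quotientProj S f = 0 ↔ f ∈ S := fun f ↦ LieSubmodule.Quotient.mk_eq_zero'
  have hφs : Function.Surjective (quotientProj S) := LieSubmodule.Quotient.surjective_mk' S
  have hmap : N.toSubmodule.map (quotientProj S : FreeLieAlgebra K X →ₗ[K] _) =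
      p.ker.toSubmodule := by
    apply le_antisymm
    · rintro _ ⟨f, hf, rfl⟩
      exact hf.1
    · intro y hy
      obtain ⟨f, rfl⟩ := hφs y
      obtain ⟨a, ha, b, hb, rfl⟩ := Submodule.mem_sup.1 (hsup (show f ∈ π.ker from hy))
      refine ⟨a, ha, ?_⟩
      change quotientProj S a = quotientProj S (a + b)
      rw [map_add, (hφ0 b).2 hb, add_zero]
  have hkill : ∀ f ∈ B, quotientProj S f = 0 := fun f hf ↦ (hφ0 f).2 (hBS hf)
  refine ⟨FreeLieAlgebra K X ⧸ S, inferInstance, inferInstance, p, ⟨?_, ?_⟩, ?_⟩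
  · intro y
    obtain ⟨f, rfl⟩ := hπ y
    exact ⟨_, hpφ f⟩
  · intro y hy
    refine ⟨?_, ?_⟩
    · intro x
      obtain ⟨f, rfl⟩ := hφs y
      obtain ⟨g, rfl⟩ := hφs x
      rw [← LieHom.map_lie, hφ0, ← lie_skew]
      exact neg_mem (hBS (LieSubmodule.lie_mem_lie (show f ∈ π.ker from hy)
        (LieSubmodule.mem_top g)))
    · have hy' : y ∈ p.ker.toSubmodule := hy
      rw [← hmap] at hy'
      obtain ⟨f, hf, rfl⟩ := hy'
      exact map_mem_lowerCentralSeries (quotientProj S) 1 hf.2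
  · have hr : LinearMap.range (multiplierMap (quotientProj S) hkill) = p.ker.toSubmodule := by
      rw [range_multiplierMap, hmap]
    have hinj : Function.Injective (multiplierMap (quotientProj S) hkill) := by
      rw [← LinearMap.ker_eq_bot, LinearMap.ker_eq_bot']
      intro x hx
      obtain ⟨⟨f, hf⟩, rfl⟩ := LieSubmodule.Quotient.surjective_mk' _ x
      have : f ∈ S := (hφ0 f).1 hx
      exact (LieSubmodule.Quotient.mk_eq_zero').2 (hinf ⟨hf, this⟩)
    exact ⟨(LinearEquiv.ofInjective _ hinj).trans (LinearEquiv.ofEq _ _ hr)⟩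

end Lifts

end StemExtensions

/-! ### Dimensions of squares, abelianizations and generating sets -/

section Dimensions

variable {K : Type u} [Field K]
variable {L E : Type u} [LieRing L] [LieAlgebra K L] [LieRing E] [LieAlgebra K E]

/-- The abelianization of `L`, as a vector space. -/
abbrev LieAb (K L : Type u) [Field K] [LieRing L] [LieAlgebra K L] : Type u :=
  L ⧸ (lieSq K L).toSubmodule

section Bracket

variable {V : Type u} [AddCommGroup V] [Module K V]

/-- The bracket of a Lie algebra, pulled back along a linear map, as an alternating map. -/
def bracketAlternating (σ : V →ₗ[K] E) : V [⋀^Fin 2]→ₗ[K] E where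
  toFun v := ⁅σ (v 0), σ (v 1)⁆
  map_update_add' v i x y := by
    fin_cases i <;> simp [Function.update]
  map_update_smul' v i c x := by
    fin_cases i <;> simp [Function.update]
  map_eq_zero_of_eq' v i j h hij := by
    fin_cases i <;> fin_cases j <;> simp_all

/-- The linear map on the second exterior power induced by the bracket. -/
noncomputable def bracketWedge (σ : V →ₗ[K] E) : ⋀[K]^2 V →ₗ[K] E :=
  exteriorPower.alternatingMapLinearEquiv (bracketAlternating σ)

theorem bracketWedge_ιMulti (σ : V →ₗ[K] E) (v : Fin 2 → V) :
    bracketWedge σ (exteriorPower.ιMulti K 2 v) = ⁅σ (v 0), σ (v 1)⁆ := by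
  rw [bracketWedge, exteriorPower.alternatingMapLinearEquiv_apply_ιMulti]
  rfl

theorem lie_mem_range_bracketWedge (σ : V →ₗ[K] E) (x y : V) :
    ⁅σ x, σ y⁆ ∈ LinearMap.range (bracketWedge σ) :=
  ⟨exteriorPower.ιMulti K 2 ![x, y], bracketWedge_ιMulti σ _⟩

theorem range_bracketWedge_le (σ : V →ₗ[K] E) :
    LinearMap.range (bracketWedge σ) ≤ (lieSq K E).toSubmodule := by
  rw [LinearMap.range_eq_map, ← exteriorPower.ιMulti_span, Submodule.map_span, Submodule.span_le]
  rintro _ ⟨_, ⟨v, rfl⟩, rfl⟩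
  rw [bracketWedge_ιMulti]
  exact lie_mem_lieSq _ _

end Bracket

/-- The square of a stem extension of a finite-dimensional Lie algebra is finite-dimensional. -/
theorem IsStem.finite_lieSq [Module.Finite K L] {p : E →ₗ⁅K⁆ L} (hp : IsStem p) :
    Module.Finite K (lieSq K E) := by
  obtain ⟨σ, hσ⟩ := (p : E →ₗ[K] L).exists_rightInverse_of_surjective
    (LinearMap.range_eq_top.2 hp.1)
  have hσ' : ∀ y, p (σ y) = y := LinearMap.congr_fun hσ
  have : (lieSq K E).toSubmodule ≤ LinearMap.range (bracketWedge σ) := by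
    rw [lieSq_le_iff]
    intro x y
    rw [hp.lie_eq_of_map_eq (hσ' (p x)).symm (hσ' (p y)).symm]
    exact lie_mem_range_bracketWedge _ _ _
  exact Submodule.finiteDimensional_of_le this

theorem IsStem.finite_ker [Module.Finite K L] {p : E →ₗ⁅K⁆ L} (hp : IsStem p) :
    Module.Finite K p.ker := by
  have := hp.finite_lieSq
  have h : p.ker.toSubmodule ≤ (lieSq K E).toSubmodule := fun x hx ↦ hp.mem_lieSq hx
  have : Module.Finite K (lieSq K E).toSubmodule := this
  exact Submodule.finiteDimensional_of_le h

theorem finite_of_finite_ker [Module.Finite K L] {p : E →ₗ⁅K⁆ L} (hp : Function.Surjective p)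
    [Module.Finite K p.ker] : Module.Finite K E := by
  have h := rank_eq_of_surjective hp
  rw [← Module.rank_lt_aleph0_iff, h]
  exact Cardinal.add_lt_aleph0 (Module.rank_lt_aleph0 K L) (Module.rank_lt_aleph0 K p.ker)

/-- Rank-nullity for `E² → L²`, whose kernel is all of `ker p` because `ker p ⊆ E²`. -/
theorem finrank_lieSq_of_stem [Module.Finite K L] {p : E →ₗ⁅K⁆ L} (hp : IsStem p) :
    Module.finrank K (lieSq K E) = Module.finrank K (lieSq K L) + Module.finrank K p.ker := by
  have h1 := hp.finite_ker
  have h2 := finite_of_finite_ker hp.1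
  have hmap : (lieSq K E).toSubmodule.map (p : E →ₗ[K] L) = (lieSq K L).toSubmodule := by
    apply le_antisymm
    · rintro _ ⟨x, hx, rfl⟩
      exact map_mem_lowerCentralSeries p 1 hx
    · intro y hy
      obtain ⟨x, rfl⟩ := hp.1 y
      exact ⟨x, hp.mem_lieSq_iff.2 hy, rfl⟩
  have h := LinearMap.finrank_range_add_finrank_ker
    ((p : E →ₗ[K] L).domRestrict (lieSq K E).toSubmodule)
  rw [LinearMap.range_domRestrict, hmap, LinearMap.ker_domRestrict] at h
  have hk : p.ker.toSubmodule ≤ (lieSq K E).toSubmodule := fun x hx ↦ hp.mem_lieSq hx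
  have := (Submodule.comapSubtypeEquivOfLe hk).finrank_eq
  change _ = Module.finrank K p.ker at this
  rw [← this]
  exact h.symm

/-- The quotient `E² / E³` is spanned by the brackets of a basis of `E / E²`. -/
theorem finrank_lieSq_le [Module.Finite K E] : Module.finrank K (lieSq K E) ≤
    (Module.finrank K (LieAb K E)).choose 2 + Module.finrank K (lieCube K E) := by
  obtain ⟨σ, hσ⟩ := (lieSq K E).toSubmodule.mkQ.exists_rightInverse_of_surjective
    (Submodule.range_mkQ _)
  have hσ' : ∀ x : E, x - σ (Submodule.Quotient.mk x) ∈ lieSq K E := fun x ↦ by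
    have := LinearMap.congr_fun hσ (Submodule.Quotient.mk x)
    exact (Submodule.Quotient.eq _).1 this.symm
  have h : (lieSq K E).toSubmodule ≤
      LinearMap.range (bracketWedge σ) ⊔ (lieCube K E).toSubmodule := by
    rw [lieSq_le_iff]
    intro x y
    set x' := σ (Submodule.Quotient.mk x)
    set y' := σ (Submodule.Quotient.mk y)
    -- Changing representatives modulo `E²` changes the bracket by an element of `E³`.
    have h1 : ⁅x, y⁆ = ⁅x', y'⁆ + (⁅x', y - y'⁆ - ⁅y, x - x'⁆) := by
      rw [lie_sub, lie_sub, ← lie_skew y x, ← lie_skew x' y]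
      abel
    rw [h1]
    exact Submodule.add_mem_sup (lie_mem_range_bracketWedge _ _ _)
      (sub_mem (lie_mem_lieCube _ (hσ' y)) (lie_mem_lieCube _ (hσ' x)))
  calc Module.finrank K (lieSq K E) ≤ _ := Submodule.finrank_mono h
    _ ≤ _ := Submodule.finrank_add_le_finrank_add_finrank _ _
    _ ≤ _ := by
      gcongr
      · rw [← exteriorPower.finrank_eq]
        exact LinearMap.finrank_range_le _
      · exact le_rfl

/-- `E²` is the full preimage of `L²`, so `E/E²` and `L/L²` are isomorphic. -/
theorem finrank_lieAb_of_stem {p : E →ₗ⁅K⁆ L} (hp : IsStem p) :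
    Module.finrank K (LieAb K E) = Module.finrank K (LieAb K L) := by
  let g : E →ₗ[K] LieAb K L := (lieSq K L).toSubmodule.mkQ ∘ₗ (p : E →ₗ[K] L)
  have hg : Function.Surjective g := (Submodule.mkQ_surjective _).comp hp.1
  have hk : LinearMap.ker g = (lieSq K E).toSubmodule := by
    ext x
    rw [LinearMap.mem_ker, LieSubmodule.mem_toSubmodule, hp.mem_lieSq_iff]
    exact Submodule.Quotient.mk_eq_zero _
  rw [← (g.quotKerEquivOfSurjective hg).finrank_eq, hk]

theorem finite_of_finite_lieAb [Module.Finite K (LieAb K L)] [Module.Finite K (lieSq K L)] :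
    Module.Finite K L := by
  have : Module.Finite K (lieSq K L).toSubmodule := ‹Module.Finite K (lieSq K L)›
  exact Module.Finite.of_submodule_quotient (lieSq K L).toSubmodule

theorem span_mkQ_image_eq_top {s : Set L} (hs : LieSubalgebra.lieSpan K L s = ⊤) :
    Submodule.span K ((lieSq K L).toSubmodule.mkQ '' s) = ⊤ := by
  let T : LieSubalgebra K L :=
    { Submodule.span K s ⊔ (lieSq K L).toSubmodule with
      lie_mem' := fun {x y} _ _ ↦ le_sup_right (a := Submodule.span K s) (lie_mem_lieSq x y) }
  have hT : T = ⊤ := by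
    rw [eq_top_iff, ← hs, LieSubalgebra.lieSpan_le]
    exact fun x hx ↦ le_sup_left (a := Submodule.span K s) (Submodule.subset_span hx)
  rw [← Submodule.map_span, eq_top_iff]
  intro y _
  obtain ⟨x, rfl⟩ := Submodule.mkQ_surjective _ y
  have hx : x ∈ T := hT ▸ LieSubalgebra.mem_top x
  obtain ⟨a, ha, b, hb, rfl⟩ := Submodule.mem_sup.1 (show x ∈ Submodule.span K s ⊔ _ from hx)
  refine ⟨a, ha, ?_⟩
  rw [map_add, left_eq_add]
  exact (Submodule.Quotient.mk_eq_zero _).2 hb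

/-- With `L²` central, brackets depend only on classes modulo `L²`; elements generated by `s`
represent every class, so their brackets already give `L²`. -/
theorem lieSpan_eq_top_of_span_mkQ (hc : lieSq K L ≤ LieAlgebra.center K L) {s : Set L}
    (hs : Submodule.span K ((lieSq K L).toSubmodule.mkQ '' s) = ⊤) :
    LieSubalgebra.lieSpan K L s = ⊤ := by
  have hd : ∀ x : L, ∃ a ∈ LieSubalgebra.lieSpan K L s, x - a ∈ lieSq K L := by
    intro x
    have hx : (lieSq K L).toSubmodule.mkQ x ∈
        Submodule.span K ((lieSq K L).toSubmodule.mkQ '' s) := hs ▸ Submodule.mem_top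
    rw [← Submodule.map_span] at hx
    obtain ⟨a, ha, hax⟩ := hx
    exact ⟨a, (Submodule.span_le.2 LieSubalgebra.subset_lieSpan :
      Submodule.span K s ≤ (LieSubalgebra.lieSpan K L s).toSubmodule) ha,
      (Submodule.Quotient.eq _).1 hax.symm⟩
  have hsq : (lieSq K L).toSubmodule ≤ (LieSubalgebra.lieSpan K L s).toSubmodule := by
    rw [lieSq_le_iff]
    intro x y
    obtain ⟨a, ha, hxa⟩ := hd x
    obtain ⟨b, hb, hyb⟩ := hd y
    have h1 : ⁅x - a, y⁆ = 0 := by rw [← lie_skew, hc hxa y, neg_zero]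
    have h2 : ⁅a, y - b⁆ = 0 := hc hyb a
    rw [sub_lie, sub_eq_zero] at h1
    rw [lie_sub, sub_eq_zero] at h2
    rw [h1, h2]
    exact LieSubalgebra.lie_mem _ ha hb
  rw [eq_top_iff]
  intro x _
  obtain ⟨a, ha, hxa⟩ := hd x
  simpa using add_mem (hsq hxa) ha

theorem finite_lieAb {d : ℕ} (hd : IsGeneratorNumber K L d) : Module.Finite K (LieAb K L) := by
  obtain ⟨s, -, hs⟩ := hd.1
  classical
  refine ⟨⟨s.image (lieSq K L).toSubmodule.mkQ, ?_⟩⟩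
  rw [Finset.coe_image]
  exact span_mkQ_image_eq_top hs

theorem finrank_lieAb {d : ℕ} (hc : lieSq K L ≤ LieAlgebra.center K L)
    (hd : IsGeneratorNumber K L d) : Module.finrank K (LieAb K L) = d := by
  classical
  have hfin := finite_lieAb hd
  apply le_antisymm
  · obtain ⟨s, rfl, hs⟩ := hd.1
    have h := span_mkQ_image_eq_top hs
    rw [← Finset.coe_image] at h
    rw [← finrank_top K, ← h]
    exact (finrank_span_finset_le_card _).trans Finset.card_image_le
  · let b := Module.finBasis K (LieAb K L)
    choose g hg using fun i ↦ Submodule.mkQ_surjective (lieSq K L).toSubmodule (b i)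
    have hs : LieSubalgebra.lieSpan K L ((Finset.univ.image g : Finset L) : Set L) = ⊤ := by
      apply lieSpan_eq_top_of_span_mkQ hc
      rw [Finset.coe_image, Finset.coe_univ, Set.image_univ, ← Set.range_comp]
      convert b.span_eq
      ext i
      exact hg i
    refine (hd.2 ⟨_, rfl, hs⟩).trans (Finset.card_image_le.trans ?_)
    simp

end Dimensions

/-! ### One-dimensional central extensions from 2-cocycles -/

section CentralExtensions

variable {K : Type u} [Field K]
variable {L : Type u} [LieRing L] [LieAlgebra K L]

/-- A scalar 2-cocycle on a Lie algebra. -/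
structure LieCocycle (K L : Type u) [Field K] [LieRing L] [LieAlgebra K L] where
  form : L →ₗ[K] L →ₗ[K] K
  form_self (x : L) : form x x = 0
  form_cyclic (x y z : L) : form ⁅x, y⁆ z + form ⁅y, z⁆ x + form ⁅z, x⁆ y = 0

theorem LieCocycle.form_swap (c : LieCocycle K L) (x y : L) : c.form x y = -c.form y x := by
  have := c.form_self (x + y)
  simp only [map_add, LinearMap.add_apply, c.form_self] at this
  linear_combination this

/-- The one-dimensional central extension of `L` given by a 2-cocycle. -/
def CentralExt (_c : LieCocycle K L) : Type u := L × K

namespace CentralExt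

variable (c : LieCocycle K L)

instance : AddCommGroup (CentralExt c) := inferInstanceAs (AddCommGroup (L × K))

instance : Module K (CentralExt c) := inferInstanceAs (Module K (L × K))

instance : Bracket (CentralExt c) (CentralExt c) where
  bracket a b := ((⁅a.1, b.1⁆, c.form a.1 b.1) : L × K)

theorem lie_def (a b : CentralExt c) : ⁅a, b⁆ = ((⁅a.1, b.1⁆, c.form a.1 b.1) : L × K) := rfl

instance : LieRing (CentralExt c) where
  add_lie a b x := Prod.ext (add_lie a.1 b.1 x.1) (LinearMap.map_add₂ c.form a.1 b.1 x.1)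
  lie_add a b x := Prod.ext (lie_add a.1 b.1 x.1) (map_add (c.form a.1) b.1 x.1)
  lie_self a := Prod.ext (lie_self a.1) (c.form_self a.1)
  leibniz_lie a b x := by
    refine Prod.ext (leibniz_lie a.1 b.1 x.1) ?_
    change c.form a.1 ⁅b.1, x.1⁆ = c.form ⁅a.1, b.1⁆ x.1 + c.form b.1 ⁅a.1, x.1⁆
    have h1 := c.form_cyclic a.1 b.1 x.1
    have h2 := c.form_swap a.1 ⁅b.1, x.1⁆
    have h3 := c.form_swap b.1 ⁅a.1, x.1⁆
    rw [← lie_skew x.1 a.1, map_neg, LinearMap.neg_apply] at h1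
    linear_combination h2 - h3 - h1

instance : LieAlgebra K (CentralExt c) where
  lie_smul t a b := Prod.ext (lie_smul t a.1 b.1) (map_smul (c.form a.1) t b.1)

/-- The element of a central extension with given components. -/
def mk (x : L) (t : K) : CentralExt c := (x, t)

/-- The projection of a central extension onto its base. -/
def proj : CentralExt c →ₗ⁅K⁆ L :=
  { LinearMap.fst K L K with map_lie' := fun {_ _} ↦ rfl }

/-- A central extension is a stem extension as soon as its square meets the kernel. -/
theorem isStem_proj {t : K} (ht : t ≠ 0)
    (h : mk c 0 t ∈ lieSq K (CentralExt c)) : IsStem (proj c) := by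
  refine ⟨fun x ↦ ⟨mk c x 0, rfl⟩, fun a ha ↦ ⟨?_, ?_⟩⟩
  · intro b
    have ha' : a.1 = 0 := ha
    rw [lie_def, ha', lie_zero, map_zero]
    rfl
  · have : a = (a.2 / t) • mk c 0 t := by
      refine Prod.ext ?_ ?_
      · exact (show a.1 = 0 from ha).trans (smul_zero (a.2 / t)).symm
      · exact (div_mul_cancel₀ a.2 ht).symm
    rw [this]
    exact (lieSq K (CentralExt c)).smul_mem _ h

end CentralExt

theorem update_vec_two_one {V : Type*} (x y z : V) : Function.update ![x, y] 1 z = ![x, z] := by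
  ext i
  fin_cases i <;> rfl

/-- The bilinear form on `L` induced by an alternating form on the abelianization is a cocycle. -/
noncomputable def LieCocycle.ofAlternating (f : LieAb K L [⋀^Fin 2]→ₗ[K] K) : LieCocycle K L where
  form := LinearMap.mk₂ K
    (fun x y ↦ f ![(lieSq K L).toSubmodule.mkQ x, (lieSq K L).toSubmodule.mkQ y])
    (fun x x' y ↦ by rw [map_add]; exact f.map_vecCons_add _ _ _)
    (fun t x y ↦ by rw [map_smul]; exact f.map_vecCons_smul _ _ _)
    (fun x y y' ↦ by
      have := f.map_update_add ![(lieSq K L).toSubmodule.mkQ x, 0] 1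
        ((lieSq K L).toSubmodule.mkQ y) ((lieSq K L).toSubmodule.mkQ y')
      simp only [update_vec_two_one] at this
      rw [map_add, this])
    (fun t x y ↦ by
      have := f.map_update_smul ![(lieSq K L).toSubmodule.mkQ x, 0] 1 t
        ((lieSq K L).toSubmodule.mkQ y)
      simp only [update_vec_two_one] at this
      rw [map_smul, this])
  form_self x := f.map_eq_zero_of_eq _ (i := 0) (j := 1) rfl (by decide)
  form_cyclic x y z := by
    -- Each term of the cyclic sum vanishes separately, since brackets die in the abelianization.
    have h (a b d : L) : f ![(lieSq K L).toSubmodule.mkQ ⁅a, b⁆,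
        (lieSq K L).toSubmodule.mkQ d] = 0 :=
      f.map_coord_zero 0 ((Submodule.Quotient.mk_eq_zero _).2 (lie_mem_lieSq a b))
    simp only [LinearMap.mk₂_apply, h, add_zero]

theorem LieCocycle.ofAlternating_form (f : LieAb K L [⋀^Fin 2]→ₗ[K] K) (x y : L) :
    (LieCocycle.ofAlternating f).form x y =
      f ![(lieSq K L).toSubmodule.mkQ x, (lieSq K L).toSubmodule.mkQ y] := rfl

theorem exists_mkQ_section : ∃ σ : LieAb K L →ₗ[K] L,
    ∀ v, (lieSq K L).toSubmodule.mkQ (σ v) = v := by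
  obtain ⟨σ, hσ⟩ := (lieSq K L).toSubmodule.mkQ.exists_rightInverse_of_surjective
    (Submodule.range_mkQ _)
  exact ⟨σ, LinearMap.congr_fun hσ⟩

/-- A Lie algebra of class at most two that is not free of class two has a nontrivial stem
extension of class at most two. -/
theorem exists_stem_lieCube_eq_bot (hc : lieSq K L ≤ LieAlgebra.center K L)
    [Module.Finite K (LieAb K L)] [Module.Finite K (lieSq K L)]
    (h : Module.finrank K (lieSq K L) < (Module.finrank K (LieAb K L)).choose 2) :
    ∃ (E : Type u) (_ : LieRing E) (_ : LieAlgebra K E) (p : E →ₗ⁅K⁆ L), IsStem p ∧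
      lieCube K E = ⊥ ∧ ∃ x, p x = 0 ∧ x ≠ 0 := by
  obtain ⟨σ, hσ⟩ := exists_mkQ_section (K := K) (L := L)
  have hfin : Module.Finite K (lieSq K L).toSubmodule := ‹Module.Finite K (lieSq K L)›
  obtain ⟨w, hw, hw0⟩ : ∃ w : ⋀[K]^2 (LieAb K L), bracketWedge σ w = 0 ∧ w ≠ 0 := by
    have hlt : Module.finrank K (lieSq K L).toSubmodule <
        Module.finrank K (⋀[K]^2 (LieAb K L)) := by
      rw [exteriorPower.finrank_eq]
      exact h
    have := LinearMap.ker_ne_bot_of_finrank_lt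
      (f := (bracketWedge σ).codRestrict (lieSq K L).toSubmodule
        fun w ↦ range_bracketWedge_le σ ⟨w, rfl⟩) hlt
    obtain ⟨w, hw, hw0⟩ := Submodule.exists_mem_ne_zero_of_ne_bot this
    exact ⟨w, congrArg Subtype.val (LinearMap.mem_ker.1 hw), hw0⟩
  obtain ⟨f, hf⟩ : ∃ f : Module.Dual K (⋀[K]^2 (LieAb K L)), f w ≠ 0 := by
    by_contra! hf
    exact hw0 ((Module.forall_dual_apply_eq_zero_iff K w).1 hf)
  set A := exteriorPower.alternatingMapLinearEquiv.symm f with hA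
  have hAf : ∀ v, A v = f (exteriorPower.ιMulti K 2 v) := fun v ↦
    exteriorPower.alternatingMapLinearEquiv_symm_apply f v
  set c := LieCocycle.ofAlternating A with hcdef
  let τ : LieAb K L →ₗ[K] CentralExt c := (LinearMap.inl K L K) ∘ₗ σ
  -- In the extension the wedge bracket acquires `f` as second coordinate, so the relation `w` of
  -- `L` becomes the nonzero central element `(0, f w)` of the square.
  have hwedge : bracketWedge τ = ((bracketWedge σ).prod f : _ →ₗ[K] L × K) := by
    apply exteriorPower.linearMap_ext
    ext v
    refine Prod.ext ?_ ?_
    · change (bracketWedge τ (exteriorPower.ιMulti K 2 v)).1 =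
        bracketWedge σ (exteriorPower.ιMulti K 2 v)
      rw [bracketWedge_ιMulti, bracketWedge_ιMulti]
      rfl
    · change (bracketWedge τ (exteriorPower.ιMulti K 2 v)).2 = f (exteriorPower.ιMulti K 2 v)
      rw [bracketWedge_ιMulti, ← hAf]
      change c.form (σ (v 0)) (σ (v 1)) = _
      rw [hcdef, LieCocycle.ofAlternating_form, hσ, hσ]
      congr 1
      ext i
      fin_cases i <;> rfl
  have hmem : CentralExt.mk c 0 (f w) ∈ lieSq K (CentralExt c) := by
    have h1 : bracketWedge τ w = CentralExt.mk c 0 (f w) := by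
      rw [hwedge, ← hw]
      rfl
    rw [← h1]
    exact range_bracketWedge_le τ ⟨w, rfl⟩
  refine ⟨CentralExt c, inferInstance, inferInstance, CentralExt.proj c,
    CentralExt.isStem_proj c hf hmem, ?_, CentralExt.mk c 0 (f w), rfl,
    fun h0 ↦ hf (congrArg Prod.snd h0)⟩
  -- The cube vanishes because the cocycle is zero once one argument lies in `L²`.
  rw [← LieSubmodule.toSubmodule_eq_bot, eq_bot_iff, lieCube_le_iff]
  intro x y hy
  have hy1 : y.1 ∈ lieSq K L := map_mem_lowerCentralSeries (CentralExt.proj c) 1 hy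
  refine (Submodule.mem_bot K).2 (Prod.ext (hc hy1 x.1) ?_)
  change c.form x.1 y.1 = 0
  rw [hcdef, LieCocycle.ofAlternating_form]
  exact A.map_coord_zero 1 ((Submodule.Quotient.mk_eq_zero _).2 hy1)

section Jacobi

variable {V : Type u} [AddCommGroup V] [Module K V]

/-- The cyclic sum of `ω [x, y] z`, as an alternating map of `x, y, z`. -/
def cyclicBracketSum (σ : V →ₗ[K] L) (ω : L →ₗ[K] V →ₗ[K] K) : V [⋀^Fin 3]→ₗ[K] K where
  toFun v := ω ⁅σ (v 0), σ (v 1)⁆ (v 2) + ω ⁅σ (v 1), σ (v 2)⁆ (v 0) +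
    ω ⁅σ (v 2), σ (v 0)⁆ (v 1)
  map_update_add' v i x y := by
    fin_cases i <;> simp [Fin.ext_iff] <;> ring
  map_update_smul' v i t x := by
    fin_cases i <;> simp [Fin.ext_iff] <;> ring
  map_eq_zero_of_eq' v i j h hij := by
    have hs (a b : V) : ω ⁅σ a, σ b⁆ = -ω ⁅σ b, σ a⁆ := by rw [← lie_skew, map_neg]
    have h0 (a b : V) : ω ⁅σ a, σ a⁆ b = 0 := by rw [lie_self, map_zero, LinearMap.zero_apply]
    have h1 (a b : V) : ω ⁅σ a, σ b⁆ a + ω ⁅σ b, σ a⁆ a = 0 := by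
      rw [hs a b, LinearMap.neg_apply, neg_add_cancel]
    -- Up to the order of `i` and `j`, two distinct indices in `Fin 3` are cyclically adjacent.
    have key : v 0 = v 1 ∨ v 1 = v 2 ∨ v 2 = v 0 := by
      revert h hij
      fin_cases i <;> fin_cases j <;> simp +contextual
    rcases key with h | h | h <;> rw [h]
    · rw [h0, zero_add, h1]
    · rw [h0, add_zero, add_comm, h1]
    · rw [h0, add_zero, h1]

end Jacobi

open TensorProduct in
/-- A Lie algebra of class at most two with sufficiently large square has a stem extension of
class three. -/
theorem exists_stem_lieCube_ne_bot (hc : lieSq K L ≤ LieAlgebra.center K L)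
    [Module.Finite K (LieAb K L)] [Module.Finite K (lieSq K L)]
    (h : (Module.finrank K (LieAb K L)).choose 3 <
      Module.finrank K (lieSq K L) * Module.finrank K (LieAb K L)) :
    ∃ (E : Type u) (_ : LieRing E) (_ : LieAlgebra K E) (p : E →ₗ⁅K⁆ L), IsStem p ∧
      lieCube K E ≠ ⊥ := by
  obtain ⟨σ, hσ⟩ := exists_mkQ_section (K := K) (L := L)
  have hfin : Module.Finite K (lieSq K L).toSubmodule := ‹Module.Finite K (lieSq K L)›
  obtain ⟨r, hr⟩ := (lieSq K L).toSubmodule.subtype.exists_leftInverse_of_injective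
    (Submodule.ker_subtype _)
  -- `T ω` measures the failure of the cocycle identity. Its source has dimension `md` and its
  -- target `C(d,3)`, so it has a nonzero kernel.
  let T : Module.Dual K ((lieSq K L).toSubmodule ⊗[K] LieAb K L) →ₗ[K]
      (LieAb K L [⋀^Fin 3]→ₗ[K] K) :=
    { toFun := fun ω ↦ cyclicBracketSum σ (TensorProduct.curry ω ∘ₗ r)
      map_add' := fun ω ω' ↦ by
        ext v
        simp [cyclicBracketSum]
        ring
      map_smul' := fun t ω ↦ by
        ext v
        simp [cyclicBracketSum]
        ring }
  have : Module.Finite K (LieAb K L [⋀^Fin 3]→ₗ[K] K) :=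
    Module.Finite.equiv exteriorPower.alternatingMapLinearEquiv.symm
  obtain ⟨ω', hω', hω0⟩ : ∃ ω, T ω = 0 ∧ ω ≠ 0 := by
    have hlt : Module.finrank K (LieAb K L [⋀^Fin 3]→ₗ[K] K) <
        Module.finrank K (Module.Dual K ((lieSq K L).toSubmodule ⊗[K] LieAb K L)) := by
      rw [(exteriorPower.alternatingMapLinearEquiv (R := K) (M := LieAb K L) (N := K)
        (n := 3)).finrank_eq, Subspace.dual_finrank_eq, Subspace.dual_finrank_eq,
        Module.finrank_tensorProduct, exteriorPower.finrank_eq]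
      exact h
    exact Submodule.exists_mem_ne_zero_of_ne_bot (LinearMap.ker_ne_bot_of_finrank_lt hlt)
  set ω := TensorProduct.curry ω' with hωdef
  set q := (lieSq K L).toSubmodule.mkQ with hq
  have hq0 {x : L} (hx : x ∈ lieSq K L) : q x = 0 := (Submodule.Quotient.mk_eq_zero _).2 hx
  have hbr (x y : L) : ⁅σ (q x), σ (q y)⁆ = ⁅x, y⁆ := by
    have hd (x : L) : x - σ (q x) ∈ lieSq K L := (Submodule.Quotient.eq _).1 (hσ (q x)).symm
    have h1 : ⁅x - σ (q x), y⁆ = 0 := by rw [← lie_skew, hc (hd x) y, neg_zero]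
    have h2 : ⁅σ (q x), y - σ (q y)⁆ = 0 := hc (hd y) _
    rw [sub_lie, sub_eq_zero] at h1
    rw [lie_sub, sub_eq_zero] at h2
    rw [h1, h2]
  -- Extend `ω` to `L` through the retraction `r` onto `L²`, then antisymmetrize. In the cocycle
  -- identity the flipped terms drop out because `q` kills brackets, leaving `T ω' = 0`.
  let B : L →ₗ[K] L →ₗ[K] K := (ω ∘ₗ r).compl₂ q
  have hB (x y : L) : B x y = ω (r x) (q y) := rfl
  let c : LieCocycle K L :=
    { form := B - B.flip
      form_self := fun x ↦ by simp
      form_cyclic := fun x y z ↦ by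
        have h1 : T ω' ![q x, q y, q z] = 0 := by rw [hω']; rfl
        have h2 : ω (r ⁅σ (q x), σ (q y)⁆) (q z) + ω (r ⁅σ (q y), σ (q z)⁆) (q x) +
          ω (r ⁅σ (q z), σ (q x)⁆) (q y) = 0 := h1
        rw [hbr, hbr, hbr] at h2
        simp only [LinearMap.sub_apply, LinearMap.flip_apply, hB, hq0 (lie_mem_lieSq _ _),
          map_zero, sub_zero]
        exact h2 }
  obtain ⟨z, v, hv⟩ : ∃ z v, ω z v ≠ 0 := by
    by_contra! hv
    exact hω0 (TensorProduct.ext' hv)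
  obtain ⟨y, rfl⟩ := Submodule.mkQ_surjective _ v
  have hsurj : Function.Surjective (CentralExt.proj c) := fun x ↦ ⟨CentralExt.mk c x 0, rfl⟩
  obtain ⟨e, he, hez⟩ := exists_mem_lowerCentralSeries_of_surjective hsurj 1 z.2
  have hform : c.form y e.1 = -ω z (q y) := by
    have h1 : e.1 = z := hez
    have h2 : r z = z := LinearMap.congr_fun hr z
    change B y e.1 - B e.1 y = _
    rw [hB, hB, h1, hq0 z.2, h2, map_zero, zero_sub]
  have hcube : CentralExt.mk c 0 (-ω z (q y)) ∈ lieCube K (CentralExt c) := by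
    have h1 := lie_mem_lieCube (CentralExt.mk c y 0) he
    have h2 : ⁅CentralExt.mk c y 0, e⁆ =
        CentralExt.mk c 0 (-ω z (q y)) := by
      refine Prod.ext ?_ hform
      have h3 : e.1 = z := hez
      change ⁅y, e.1⁆ = 0
      rw [h3]
      exact hc z.2 y
    rwa [h2] at h1
  refine ⟨CentralExt c, inferInstance, inferInstance, CentralExt.proj c,
    CentralExt.isStem_proj c (neg_ne_zero.2 hv) (lieCube_le_lieSq hcube), fun h0 ↦ ?_⟩
  rw [h0, LieSubmodule.mem_bot] at hcube
  exact neg_ne_zero.2 hv (congrArg Prod.snd hcube)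

end CentralExtensions

/-! ### Covers as maximal stem extensions -/

section Covers

variable {K : Type u} [Field K]
variable {L E : Type u} [LieRing L] [LieAlgebra K L] [LieRing E] [LieAlgebra K E]
variable {X : Type u} {π : FreeLieAlgebra K X →ₗ⁅K⁆ L}

theorem finite_schurMultiplier [Module.Finite K L] (hπ : Function.Surjective π) :
    Module.Finite K (SchurMultiplier π) := by
  obtain ⟨E, _, _, p, hp, ⟨e⟩⟩ := exists_stem_of_multiplier hπ
  have := hp.finite_ker
  exact Module.Finite.equiv e.symm

/-- A cover is a stem extension whose kernel is as large as the Schur multiplier. -/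
theorem isCover_iff_exists_stem [Module.Finite K L] (hπ : Function.Surjective π) :
    IsCover K L E ↔ ∃ p : E →ₗ⁅K⁆ L, IsStem p ∧
      Module.finrank K p.ker = Module.finrank K (SchurMultiplier π) := by
  have hfin := finite_schurMultiplier hπ
  constructor
  · rintro ⟨⟨M, hM⟩, hmax⟩
    obtain ⟨p, hp, rfl⟩ := isDefiningPair_iff.1 hM
    obtain ⟨E₀, _, _, p₀, hp₀, ⟨e⟩⟩ := exists_stem_of_multiplier hπ
    have hle := hmax E₀ p₀.ker (isDefiningPair_iff.2 ⟨p₀, hp₀, rfl⟩)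
    have := hp.finite_ker
    rw [rank_eq_of_surjective hp.1, rank_eq_of_surjective hp₀.1, ← e.rank_eq,
      ← Module.finrank_eq_rank, ← Module.finrank_eq_rank, ← Module.finrank_eq_rank] at hle
    have hle' := rank_ker_le hπ hp
    rw [← Module.finrank_eq_rank, ← Module.finrank_eq_rank] at hle'
    norm_cast at hle hle'
    exact ⟨p, hp, by omega⟩
  · rintro ⟨p, hp, hdim⟩
    refine ⟨⟨p.ker, isDefiningPair_iff.2 ⟨p, hp, rfl⟩⟩, fun E' _ _ M' hM' ↦ ?_⟩
    obtain ⟨p', hp', rfl⟩ := isDefiningPair_iff.1 hM'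
    have := hp.finite_ker
    rw [rank_eq_of_surjective hp.1, rank_eq_of_surjective hp'.1]
    gcongr
    refine (rank_ker_le hπ hp').trans ?_
    rw [← Module.finrank_eq_rank, ← Module.finrank_eq_rank, hdim]

theorem isNilpotentOfClass_three_iff :
    IsNilpotentOfClass E 3 ↔ lieCube K E ≤ LieAlgebra.center K E ∧ lieCube K E ≠ ⊥ := by
  have hcen : LieModule.lowerCentralSeries K E E 3 = ⊥ ↔
      lieCube K E ≤ LieAlgebra.center K E := by
    rw [LieModule.lowerCentralSeries_succ, LieSubmodule.lie_eq_bot_iff]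
    exact ⟨fun h x hx y ↦ h y (LieSubmodule.mem_top y) x hx, fun h y _ x hx ↦ h hx y⟩
  rw [IsNilpotentOfClass, LieModule.nilpotencyLength_eq_succ_iff K, hcen]
  refine ⟨fun h ↦ h.2, fun h ↦ ⟨?_, h⟩⟩
  exact LieModule.IsNilpotent.mk E (hcen.2 h.1)

/-- A finite-dimensional central ideal is an abelian Lie algebra. -/
theorem nonempty_equiv_abelianLie {I : LieIdeal K E} (hI : I ≤ LieAlgebra.center K E)
    [Module.Finite K I] {n : ℕ} (hn : Module.finrank K I = n) :
    Nonempty (I ≃ₗ⁅K⁆ AbelianLie K n) := by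
  let e : I ≃ₗ[K] (Fin n → K) := (Module.finBasisOfFinrankEq K I hn).equivFun
  refine ⟨{ e with map_lie' := fun {x y} ↦ ?_ }⟩
  have h : ⁅x, y⁆ = 0 := Subtype.ext (hI y.2 x)
  change e ⁅x, y⁆ = 0
  rw [h, map_zero]

theorem finrank_abelianLie (n : ℕ) : Module.finrank K (AbelianLie K n) = n :=
  Module.finrank_fin_fun K

theorem finite_abelianLie (n : ℕ) : Module.Finite K (AbelianLie K n) :=
  inferInstanceAs (Module.Finite K (Fin n → K))

theorem isCover_of_hasCubeMultiplier [Module.Finite K L] (hπ : Function.Surjective π)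
    (hcl : IsNilpotentOfClass E 3) (h : HasCubeMultiplier π E) : IsCover K L E := by
  obtain ⟨⟨e⟩, hq⟩ := h
  have hcen := (isNilpotentOfClass_three_iff (K := K).1 hcl).1
  obtain ⟨p, hp, hker⟩ := isDefiningPair_iff.1 ⟨le_inf hcen lieCube_le_lieSq, hq⟩
  refine (isCover_iff_exists_stem hπ).2 ⟨p, hp, ?_⟩
  rw [hker]
  exact e.toLinearEquiv.finrank_eq

theorem isCover_of_hasCubeSplitting [Module.Finite K L] (hπ : Function.Surjective π)
    (hcl : IsNilpotentOfClass E 3) (hZ : LieAlgebra.center K E ≤ lieSq K E) {j : ℕ}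
    (h : HasCubeSplitting π E j) : IsCover K L E := by
  obtain ⟨⟨n, hn, ⟨e⟩⟩, A, hA, ⟨e'⟩, hdisj, hq⟩ := h
  have hcen := (isNilpotentOfClass_three_iff (K := K).1 hcl).1
  have hle : lieCube K E ⊔ A ≤ LieAlgebra.center K E := sup_le hcen hA
  obtain ⟨p, hp, hker⟩ := isDefiningPair_iff.1 ⟨le_inf hle (hle.trans hZ), hq⟩
  refine (isCover_iff_exists_stem hπ).2 ⟨p, hp, ?_⟩
  rw [hker, ← hn]
  have := finite_abelianLie (K := K) n
  have := finite_abelianLie (K := K) j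
  have h1 : Module.Finite K (lieCube K E).toSubmodule := Module.Finite.equiv e.toLinearEquiv.symm
  have h2 : Module.Finite K A.toSubmodule := Module.Finite.equiv e'.toLinearEquiv.symm
  have h3 : Module.finrank K (lieCube K E).toSubmodule = n :=
    e.toLinearEquiv.finrank_eq.trans (finrank_abelianLie n)
  have h4 : Module.finrank K A.toSubmodule = j :=
    e'.toLinearEquiv.finrank_eq.trans (finrank_abelianLie j)
  have hsum := Submodule.finrank_sup_add_finrank_inf_eq (lieCube K E).toSubmodule A.toSubmodule
  have hinf : (lieCube K E).toSubmodule ⊓ A.toSubmodule = ⊥ := by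
    rw [← LieSubmodule.inf_toSubmodule, hdisj.eq_bot, LieSubmodule.bot_toSubmodule]
  rw [hinf, finrank_bot, add_zero, h3, h4, ← LieSubmodule.sup_toSubmodule] at hsum
  exact hsum

/-- If some stem extension of a Lie algebra of class at most two has class three, then so do all
its covers. -/
theorem lieCube_ne_bot_of_stem {E' : Type u} [LieRing E'] [LieAlgebra K E']
    (hπ : Function.Surjective π) [Module.Finite K (SchurMultiplier π)]
    (hL : lieCube K L = ⊥) {p : E →ₗ⁅K⁆ L} (hp : IsStem p)
    (hdim : Module.finrank K p.ker = Module.finrank K (SchurMultiplier π))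
    {p' : E' →ₗ⁅K⁆ L} (hp' : IsStem p') (hE' : lieCube K E' ≠ ⊥) : lieCube K E ≠ ⊥ := by
  intro hE
  obtain ⟨φ, hφ⟩ := exists_lift π hp.1
  obtain ⟨φ', hφ'⟩ := exists_lift π hp'.1
  refine hE' (eq_bot_iff.2 fun y hy ↦ ?_)
  obtain ⟨f, hf, rfl⟩ :=
    exists_mem_lowerCentralSeries_of_surjective (lift_surjective hπ hp' hφ') 2 hy
  have h1 : π f ∈ lieCube K L := map_mem_lowerCentralSeries π 2 hf
  have h2 : φ f ∈ lieCube K E := map_mem_lowerCentralSeries φ 2 hf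
  rw [hL, LieSubmodule.mem_bot] at h1
  rw [hE, LieSubmodule.mem_bot] at h2
  -- `F³ ⊆ R ∩ F²` because `L³ = 0`; if the cover kills `F³`, then `F³ ⊆ [R, F]`, which every stem
  -- extension kills.
  exact (LieSubmodule.mem_bot _).2 (lift_eq_zero_of_mem hp' hφ'
    (mem_of_lift_eq_zero hπ hp hφ hdim h1 (lieCube_le_lieSq hf) h2))

/-- If a Lie algebra of class at most two has a nontrivial stem extension of class at most two,
then the kernel of a cover is not contained in the cube. -/
theorem not_ker_le_lieCube_of_stem {E' : Type u} [LieRing E'] [LieAlgebra K E']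
    (hπ : Function.Surjective π) [Module.Finite K (SchurMultiplier π)]
    (hL : lieCube K L = ⊥) {p : E →ₗ⁅K⁆ L} (hp : IsStem p)
    (hdim : Module.finrank K p.ker = Module.finrank K (SchurMultiplier π))
    {p' : E' →ₗ⁅K⁆ L} (hp' : IsStem p') (hE' : lieCube K E' = ⊥)
    {x : E'} (hx : p' x = 0) (hx0 : x ≠ 0) : ¬ p.ker ≤ lieCube K E := by
  intro hle
  obtain ⟨φ, hφ⟩ := exists_lift π hp.1
  obtain ⟨φ', hφ'⟩ := exists_lift π hp'.1
  obtain ⟨f, hf, rfl⟩ := exists_lieSq_lift hπ hp' hφ' (hp'.mem_lieSq hx)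
  have hπf : π f = 0 := (hφ' f).symm.trans hx
  obtain ⟨g, hg, hgf⟩ := exists_mem_lowerCentralSeries_of_surjective (lift_surjective hπ hp hφ) 2
    (hle (show φ f ∈ p.ker from (hφ f).trans hπf))
  have hπg : π g ∈ lieCube K L := map_mem_lowerCentralSeries π 2 hg
  have hφg : φ' g ∈ lieCube K E' := map_mem_lowerCentralSeries φ' 2 hg
  rw [hL, LieSubmodule.mem_bot] at hπg
  rw [hE', LieSubmodule.mem_bot] at hφg
  -- `f` and `g ∈ F³` agree in the cover, hence modulo `[R, F]`, hence in `E'`, where `g` maps into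
  -- `E'³ = 0`.
  have h := lift_eq_zero_of_mem hp' hφ' (mem_of_lift_eq_zero hπ hp hφ hdim (f := f - g)
    (by rw [map_sub, hπf, hπg, sub_zero]) (sub_mem hf (lieCube_le_lieSq hg))
    (by rw [map_sub, hgf, sub_self]))
  rw [map_sub, hφg, sub_zero] at h
  exact hx0 h

/-- A stem extension of class three whose kernel properly contains the cube splits accordingly. -/
theorem hasCubeSplitting_of_stem [Module.Finite K L] {p : E →ₗ⁅K⁆ L} (hp : IsStem p)
    (hdim : Module.finrank K p.ker = Module.finrank K (SchurMultiplier π))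
    (hle : lieCube K E ≤ p.ker) {j : ℕ}
    (hj : Module.finrank K (lieCube K E) + j = Module.finrank K p.ker) :
    HasCubeSplitting π E j := by
  have hker := hp.finite_ker
  have hE := finite_of_finite_ker hp.1
  have hkc : p.ker ≤ LieAlgebra.center K E := hp.2.trans inf_le_left
  obtain ⟨C, hC⟩ := Submodule.exists_isCompl (lieCube K E).toSubmodule
  let A : LieIdeal K E :=
    { C ⊓ p.ker.toSubmodule with
      lie_mem := fun {x y} hy ↦ by
        rw [hkc hy.2 x]
        exact zero_mem (C ⊓ p.ker.toSubmodule) }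
  have hAc : A ≤ LieAlgebra.center K E := fun x hx ↦ hkc hx.2
  have hinf : (lieCube K E).toSubmodule ⊓ A.toSubmodule = ⊥ := by
    rw [eq_bot_iff, ← hC.inf_eq_bot]
    exact inf_le_inf_left _ inf_le_left
  have hsup : (lieCube K E).toSubmodule ⊔ A.toSubmodule = p.ker.toSubmodule := by
    have := sup_inf_assoc_of_le C (show (lieCube K E).toSubmodule ≤ p.ker.toSubmodule from hle)
    rw [hC.sup_eq_top, top_inf_eq] at this
    exact this.symm
  have hsup' : lieCube K E ⊔ A = p.ker := by
    rw [← LieSubmodule.toSubmodule_inj, LieSubmodule.sup_toSubmodule, hsup]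
  have hsum := Submodule.finrank_sup_add_finrank_inf_eq (lieCube K E).toSubmodule A.toSubmodule
  rw [hinf, hsup, finrank_bot, add_zero] at hsum
  have hcube : Module.Finite K (lieCube K E) :=
    inferInstanceAs (Module.Finite K (lieCube K E).toSubmodule)
  have hA : Module.Finite K A := inferInstanceAs (Module.Finite K A.toSubmodule)
  have hjA : Module.finrank K A = j := by
    change _ = Module.finrank K (lieCube K E) + Module.finrank K A at hsum
    change Module.finrank K p.ker = _ at hsum
    omega
  refine ⟨⟨Module.finrank K (lieCube K E), hj.trans hdim,
    nonempty_equiv_abelianLie (hle.trans hkc) rfl⟩, A, hAc, nonempty_equiv_abelianLie hAc hjA,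
    ?_, ?_⟩
  · rw [disjoint_iff, ← LieSubmodule.toSubmodule_eq_bot, LieSubmodule.inf_toSubmodule, hinf]
  · rw [hsup']
    exact nonempty_quotKer_equiv hp.1

theorem center_le_lieSq_of_stem (hZ : LieAlgebra.center K L ≤ lieSq K L) {p : E →ₗ⁅K⁆ L}
    (hp : IsStem p) : LieAlgebra.center K E ≤ lieSq K E := by
  intro x hx
  rw [hp.mem_lieSq_iff]
  refine hZ fun y ↦ ?_
  obtain ⟨y, rfl⟩ := hp.1 y
  rw [← LieHom.map_lie, hx y, map_zero]

theorem lieCube_eq_bot (hc : lieSq K L ≤ LieAlgebra.center K L) : lieCube K L = ⊥ := by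
  rw [← LieSubmodule.toSubmodule_eq_bot, eq_bot_iff, lieCube_le_iff]
  exact fun x y hy ↦ (Submodule.mem_bot K).2 (hc hy x)

/-! ### Generalized Heisenberg algebras: numerical bounds and conclusion -/

section Heisenberg

variable {d m r : ℕ}

/-- If `L² = 0` then `L` is its own centre, so `L = Z(L) = L² = 0` and `d = 0`. -/
theorem IsGeneralizedHeisenberg.pos_of_generatorNumber (hL : IsGeneralizedHeisenberg K L m)
    (hd : IsGeneratorNumber K L d) (hd0 : 0 < d) : 0 < m := by
  obtain ⟨hc, hfin, hm⟩ := hL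
  by_contra! hm0
  have hm0 : Module.finrank K (lieSq K L).toSubmodule = 0 := hm.trans (Nat.le_zero.1 hm0)
  have hfin' : Module.Finite K (lieSq K L).toSubmodule := hfin
  have hbot : lieSq K L = ⊥ := by
    rw [← LieSubmodule.toSubmodule_eq_bot]
    exact Submodule.finrank_eq_zero.1 hm0
  have hsub (x : L) : x = 0 := by
    have hx : x ∈ LieAlgebra.center K L := fun y ↦ by
      have := lie_mem_lieSq (K := K) y x
      rwa [hbot, LieSubmodule.mem_bot] at this
    rwa [← hc, hbot, LieSubmodule.mem_bot] at hx
  have : Subsingleton L := ⟨fun x y ↦ by rw [hsub x, hsub y]⟩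
  have h := finrank_lieAb hc.le hd
  have : Subsingleton (LieAb K L) := (Submodule.mkQ_surjective (lieSq K L).toSubmodule).subsingleton
  rw [Module.finrank_zero_of_subsingleton] at h
  omega

/-- Substituting `m = d(d-1)/2 - r` turns the claim into `3r < (d-1)(d+1)` for `d > 0`. This fails
for `d = 3`, `r = 3`, the case that `0 < m` excludes. -/
theorem choose_three_lt (hm : 0 < m) (hr0 : 0 < r) (hr : r ≤ 3) (h : m + r = d.choose 2) :
    d.choose 3 < m * d := by
  have h3 := Nat.choose_succ_right_eq d 2
  have h2 := Nat.choose_succ_right_eq d 1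
  rw [Nat.choose_one_right] at h2
  simp only [Nat.reduceAdd] at h2 h3
  have hd : 3 ≤ d := by
    by_contra! hd
    interval_cases d <;> simp [Nat.choose] at h <;> omega
  have hd' : r = 3 → 4 ≤ d := by
    rintro rfl
    by_contra! hd4
    obtain rfl : d = 3 := by omega
    simp [Nat.choose] at h
    omega
  obtain ⟨e, rfl⟩ := Nat.exists_eq_add_of_le hd
  have e1 : 3 + e - 1 = e + 2 := by omega
  have e2 : 3 + e - 2 = e + 1 := by omega
  rw [e1, ← h] at h2
  rw [e2, ← h] at h3
  have key : 3 * r < (e + 2) * (e + 4) := by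
    rcases Nat.lt_or_ge r 3 with hr' | hr'
    · nlinarith
    · have := hd' (le_antisymm hr hr')
      nlinarith [show 1 ≤ e by omega]
  nlinarith

/-- The covers of a generalized Heisenberg Lie algebra of rank `d(d-1)/2 - r`. -/
theorem isCover_iff_of_isGeneralizedHeisenberg (hπ : Function.Surjective π)
    (hd : IsGeneratorNumber K L d) (hL : IsGeneralizedHeisenberg K L m) (hr0 : 0 < r)
    (hr : r ≤ 3) (hm : m + r = d * (d - 1) / 2) :
    Module.Finite K (SchurMultiplier π) ∧ (IsCover K L E ↔
      IsNilpotentOfClass E 3 ∧ LieAlgebra.center K E ≤ lieSq K E ∧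
        (HasCubeMultiplier π E ∨ ∃ j, 1 ≤ j ∧ j ≤ r ∧ HasCubeSplitting π E j)) := by
  rw [← Nat.choose_two_right] at hm
  have hc : lieSq K L ≤ LieAlgebra.center K L := hL.1.le
  have := finite_lieAb hd
  have := hL.2.1
  have := finite_of_finite_lieAb (K := K) (L := L)
  have hmult := finite_schurMultiplier hπ
  have hV := finrank_lieAb hc hd
  refine ⟨hmult, fun hcov ↦ ?_, ?_⟩
  · obtain ⟨p, hp, hdim⟩ := (isCover_iff_exists_stem hπ).1 hcov
    have hL3 := lieCube_eq_bot hc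
    have hker := hp.finite_ker
    have hE := finite_of_finite_ker hp.1
    have hle : lieCube K E ≤ p.ker := fun x hx ↦ by
      have := map_mem_lowerCentralSeries p 2 hx
      rwa [show LieModule.lowerCentralSeries K L L 2 = ⊥ from hL3, LieSubmodule.mem_bot] at this
    have hd0 : 0 < d := by
      by_contra! hd0
      obtain rfl := Nat.le_zero.1 hd0
      simp at hm
      omega
    obtain ⟨E₁, _, _, p₁, hp₁, hE₁⟩ := exists_stem_lieCube_ne_bot hc
      (by rw [hV, hL.2.2]; exact choose_three_lt (hL.pos_of_generatorNumber hd hd0) hr0 hr hm)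
    obtain ⟨E₂, _, _, p₂, hp₂, hE₂, x, hx, hx0⟩ := exists_stem_lieCube_eq_bot hc
      (by rw [hV, hL.2.2]; omega)
    have hne := lieCube_ne_bot_of_stem hπ hL3 hp hdim hp₁ hE₁
    have hnle := not_ker_le_lieCube_of_stem hπ hL3 hp hdim hp₂ hE₂ hx hx0
    have hlt : Module.finrank K (lieCube K E) < Module.finrank K p.ker :=
      Submodule.finrank_lt_finrank_of_lt (s := (lieCube K E).toSubmodule)
        (t := p.ker.toSubmodule) (lt_of_le_not_ge hle hnle)
    have hsq := finrank_lieSq_of_stem hp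
    have hsq' := finrank_lieSq_le (K := K) (E := E)
    -- Now `m + dim ker p ≤ d(d-1)/2 + dim E³`, which is `j ≤ r`; `hlt` gives `1 ≤ j`.
    rw [finrank_lieAb_of_stem hp, hV, hsq, hL.2.2] at hsq'
    refine ⟨isNilpotentOfClass_three_iff.2 ⟨hle.trans (hp.2.trans inf_le_left), hne⟩,
      center_le_lieSq_of_stem hL.1.ge hp,
      .inr ⟨Module.finrank K p.ker - Module.finrank K (lieCube K E), by omega, by omega,
        hasCubeSplitting_of_stem hp hdim hle (by omega)⟩⟩
  · rintro ⟨hcl, hZ, h | ⟨j, -, -, h⟩⟩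
    · exact isCover_of_hasCubeMultiplier hπ hcl h
    · exact isCover_of_hasCubeSplitting hπ hcl hZ h

end Heisenberg

end Covers

theorem mainTheorem7 {K : Type u} [Field K]
    {L : Type u} [LieRing L] [LieAlgebra K L]
    {X : Type u} (π : FreeLieAlgebra K X →ₗ⁅K⁆ L) (hπ : Function.Surjective π)
    (d m : ℕ) (hd : IsGeneratorNumber K L d) (hL : IsGeneralizedHeisenberg K L m)
    (Lstar : Type u) [LieRing Lstar] [LieAlgebra K Lstar] :
    (m + 1 = d * (d - 1) / 2 →
      Module.Finite K (SchurMultiplier π) ∧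
      (IsCover K L Lstar ↔
        IsNilpotentOfClass Lstar 3 ∧ LieAlgebra.center K Lstar ≤ lieSq K Lstar ∧
          (HasCubeMultiplier π Lstar ∨ HasCubeSplitting π Lstar 1))) ∧
    (m + 2 = d * (d - 1) / 2 →
      Module.Finite K (SchurMultiplier π) ∧
      (IsCover K L Lstar ↔
        IsNilpotentOfClass Lstar 3 ∧ LieAlgebra.center K Lstar ≤ lieSq K Lstar ∧
          (HasCubeMultiplier π Lstar ∨ HasCubeSplitting π Lstar 1 ∨
            HasCubeSplitting π Lstar 2))) ∧
    (m + 3 = d * (d - 1) / 2 →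
      Module.Finite K (SchurMultiplier π) ∧
      (IsCover K L Lstar ↔
        IsNilpotentOfClass Lstar 3 ∧ LieAlgebra.center K Lstar ≤ lieSq K Lstar ∧
          (HasCubeMultiplier π Lstar ∨ HasCubeSplitting π Lstar 1 ∨
            HasCubeSplitting π Lstar 2 ∨ HasCubeSplitting π Lstar 3))) := by
  refine ⟨fun hm ↦ ?_, fun hm ↦ ?_, fun hm ↦ ?_⟩
  · obtain ⟨hfin, h⟩ := isCover_iff_of_isGeneralizedHeisenberg (E := Lstar) hπ hd hL
      one_pos (by norm_num) hm
    refine ⟨hfin, h.trans (and_congr_right' (and_congr_right' (or_congr_right ?_)))⟩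
    constructor
    · rintro ⟨j, h1, h2, hj⟩
      obtain rfl : j = 1 := by omega
      exact hj
    · exact fun hj ↦ ⟨1, le_rfl, le_rfl, hj⟩
  · obtain ⟨hfin, h⟩ := isCover_iff_of_isGeneralizedHeisenberg (E := Lstar) hπ hd hL
      two_pos (by norm_num) hm
    refine ⟨hfin, h.trans (and_congr_right' (and_congr_right' (or_congr_right ?_)))⟩
    constructor
    · rintro ⟨j, h1, h2, hj⟩
      obtain rfl | rfl : j = 1 ∨ j = 2 := by omega
      exacts [.inl hj, .inr hj]
    · rintro (hj | hj)
      exacts [⟨1, le_rfl, by norm_num, hj⟩, ⟨2, by norm_num, le_rfl, hj⟩]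
  · obtain ⟨hfin, h⟩ := isCover_iff_of_isGeneralizedHeisenberg (E := Lstar) hπ hd hL
      three_pos le_rfl hm
    refine ⟨hfin, h.trans (and_congr_right' (and_congr_right' (or_congr_right ?_)))⟩
    constructor
    · rintro ⟨j, h1, h2, hj⟩
      obtain rfl | rfl | rfl : j = 1 ∨ j = 2 ∨ j = 3 := by omega
      exacts [.inl hj, .inr (.inl hj), .inr (.inr hj)]
    · rintro (hj | hj | hj)
      exacts [⟨1, le_rfl, by norm_num, hj⟩, ⟨2, by norm_num, by norm_num, hj⟩,
        ⟨3, by norm_num, le_rfl, hj⟩]
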